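/- Let $(A,\mathfrak m)$ be a Noetherian local normal domain with fraction field $K$. Let $f\in K[x]$ be an irreducible polynomial such that $K[x]/(f)$ is separable over $K$. Let $\overline L$ be a splitting field of $f$ over $K$, a finite Galois extension with Galois group $G$, let $V\subset\overline L$ be the set of roots of $f$, and let $\overline B$ be the integral closure of $A$ in $\overline L$. Let $\overline{\mathfrak m}$ be a prime ideal of $\overline B$ lying over $\mathfrak m$, with decomposition group $D=\{\sigma\in G:\sigma(\overline{\mathfrak m})=\overline{\mathfrak m}\}$. Assume that the completions $\hat A=\varprojlim A/\mathfrak m^n$ and $\overline B_{\overline{\mathfrak m}}=\varprojlim\overline B/\overline{\mathfrak m}^n$ are domains, and let $K_{\mathfrak m}$ and $\overline L_{\overline{\mathfrak m}}$ be their fraction fields. The natural maps give embeddings $K\subset K_{\mathfrak m}\subset\overline L_{\overline{\mathfrak m}}$ and $e:\overline L\to\overline L_{\overline{\mathfrak m}}$, and $D$ acts on $\overline L_{\overline{\mathfrak m}}$ by $K_{\mathfrak m}$-automorphisms, through its action on the completion $\overline B_{\overline{\mathfrak m}}$. Let $V_i$ be the orbits of $D$ on $V$, and let $$i_1:D\to\prod_i\mathrm{Aut}(V_i)$$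 be the homomorphism given by the action of $D$ on these orbits. For each monic irreducible factor $g$ of $f$ over $K_{\mathfrak m}$ let $V_g$ be its set of roots in $\overline L_{\overline{\mathfrak m}}$. The group $D$ acts on every $V_g$; let $$i_2:D\to\prod_g\mathrm{Aut}(V_g)$$ be the resulting homomorphism. Theorem. The homomorphism $i_2$ is injective. There is a bijection $V_i\mapsto f_i$ from the set of $D$-orbits on $V$ to the set of monic irreducible factors of $f$ over $K_{\mathfrak m}$, together with bijections $V_i\simeq V_{f_i}$ given by restricting $e$, such that the induced isomorphism $j:\prod_i\mathrm{Aut}(V_i)\to\prod_i\mathrm{Aut}(V_{f_i})$ satisfies $i_2=j\circ i_1$. -/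

import Mathlib

open Polynomial IsLocalRing

noncomputable section

namespace CompletionGalois

/-! ### Functoriality of adic completions of rings -/

section Completion

variable {R S T : Type*} [CommRing R] [CommRing S] [CommRing T]

theorem completionMap_compat (I : Ideal R) (J : Ideal S) (φ : R →+* S) (h : I ≤ J.comap φ)
    {a b : ℕ} (hle : a ≤ b) :
    (Ideal.Quotient.factorPow J hle).comp ((Ideal.quotientMap (J ^ b) φ
      ((Ideal.pow_right_mono h b).trans (Ideal.le_comap_pow φ b))).comp
        (AdicCompletion.evalₐ I b : AdicCompletion I R →+* R ⧸ I ^ b)) =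
    (Ideal.quotientMap (J ^ a) φ
      ((Ideal.pow_right_mono h a).trans (Ideal.le_comap_pow φ a))).comp
        (AdicCompletion.evalₐ I a : AdicCompletion I R →+* R ⧸ I ^ a) := by
  ext x
  obtain ⟨x, rfl⟩ := AdicCompletion.mk_surjective I R x
  simp only [RingHom.comp_apply, RingHom.coe_coe, AdicCompletion.evalₐ_mk,
    Ideal.quotientMap_mk]
  change Ideal.Quotient.mk (J ^ a) (φ (x.val b)) = Ideal.Quotient.mk (J ^ a) (φ (x.val a))
  rw [Ideal.Quotient.eq, ← map_sub]
  refine Ideal.le_comap_pow φ a (Ideal.pow_right_mono h a ?_)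
  rw [← Ideal.Quotient.eq]
  exact (AdicCompletion.Ideal.mk_eq_mk I hle x)

/-- The ring homomorphism `lim R/I^n → lim S/J^n` induced by `φ : R → S` with `I ⊆ φ⁻¹(J)`. -/
def completionMap (I : Ideal R) (J : Ideal S) (φ : R →+* S) (h : I ≤ J.comap φ) :
    AdicCompletion I R →+* AdicCompletion J S :=
  AdicCompletion.liftRingHom J
    (fun n => (Ideal.quotientMap (J ^ n) φ
      ((Ideal.pow_right_mono h n).trans (Ideal.le_comap_pow φ n))).comp
        (AdicCompletion.evalₐ I n : AdicCompletion I R →+* R ⧸ I ^ n))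
    (completionMap_compat I J φ h)

theorem evalₐ_completionMap (I : Ideal R) (J : Ideal S) (φ : R →+* S) (h : I ≤ J.comap φ)
    (n : ℕ) (x : AdicCompletion I R) (r : R)
    (hr : AdicCompletion.evalₐ I n x = Ideal.Quotient.mk (I ^ n) r) :
    AdicCompletion.evalₐ J n (completionMap I J φ h x) = Ideal.Quotient.mk (J ^ n) (φ r) := by
  refine (AdicCompletion.evalₐ_liftRingHom J _ (completionMap_compat I J φ h) n x).trans ?_
  rw [RingHom.comp_apply, RingHom.coe_coe, hr, Ideal.quotientMap_mk]

theorem completionMap_algebraMap (I : Ideal R) (J : Ideal S) (φ : R →+* S) (h : I ≤ J.comap φ)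
    (r : R) : completionMap I J φ h (algebraMap R _ r) = algebraMap S _ (φ r) := by
  refine AdicCompletion.ext_evalₐ fun n => ?_
  rw [evalₐ_completionMap I J φ h n _ r (by simp)]
  simp

theorem completionMap_id (I : Ideal R) (φ : R →+* R) (hφ : φ = RingHom.id R)
    (h : I ≤ I.comap φ) : completionMap I I φ h = RingHom.id _ := by
  subst hφ
  ext x : 1
  refine AdicCompletion.ext_evalₐ fun n => ?_
  obtain ⟨r, hr⟩ := Ideal.Quotient.mk_surjective (AdicCompletion.evalₐ I n x)
  rw [evalₐ_completionMap I I _ h n _ r hr.symm, RingHom.id_apply, RingHom.id_apply, hr]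

theorem completionMap_comp (I : Ideal R) (J : Ideal S) (Q : Ideal T) (φ : R →+* S) (ψ : S →+* T)
    (χ : R →+* T) (hχ : χ = ψ.comp φ)
    (h : I ≤ J.comap φ) (h' : J ≤ Q.comap ψ) (h'' : I ≤ Q.comap χ) :
    completionMap I Q χ h'' = (completionMap J Q ψ h').comp (completionMap I J φ h) := by
  subst hχ
  ext x : 1
  refine AdicCompletion.ext_evalₐ fun n => ?_
  obtain ⟨r, hr⟩ := Ideal.Quotient.mk_surjective (AdicCompletion.evalₐ I n x)
  rw [evalₐ_completionMap I Q _ h'' n _ r hr.symm]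
  exact (evalₐ_completionMap J Q ψ h' n _ (φ r)
    (evalₐ_completionMap I J φ h n _ r hr.symm)).symm

theorem algebraMap_completion_injective [IsDomain R] [IsNoetherianRing R] (I : Ideal R)
    (hI : I ≠ ⊤) : Function.Injective (algebraMap R (AdicCompletion I R)) := by
  rw [injective_iff_map_eq_zero]
  intro r hr
  have hmem : r ∈ (⨅ n : ℕ, I ^ n : Ideal R) := by
    rw [Ideal.mem_iInf]
    intro n
    have h0 := congrArg (AdicCompletion.evalₐ I n) hr
    rw [map_zero, AlgHom.commutes] at h0
    exact Ideal.Quotient.eq_zero_iff_mem.mp h0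
  rwa [Ideal.iInf_pow_eq_bot_of_isDomain I hI] at hmem

end Completion

/-! ### The Galois extension, decomposition groups and local fields -/

section Galois

variable (A K : Type*) {L B : Type*}
  [CommRing A]
  [Field K] [Algebra A K] [IsFractionRing A K]
  [Field L] [Algebra K L] [IsGalois K L]
  [Algebra A L] [IsScalarTower A K L]
  [CommRing B] [Algebra A B] [Algebra B L] [IsScalarTower A B L] [IsIntegralClosure B A L]

/-- The decomposition group `{σ ∈ Gal(L/K) : σ(P) = P}` of an ideal `P` of the integral
closure `B` of `A` in `L`. -/
def decompositionGroup (P : Ideal B) : Subgroup Gal(L/K) where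
  carrier := {σ | P.map (galRestrict A K L B σ) = P}
  one_mem' := by
    change P.map (galRestrict A K L B 1) = P
    rw [map_one]
    exact Ideal.map_id P
  mul_mem' := by
    intro σ τ hσ hτ
    change P.map (galRestrict A K L B (σ * τ)) = P
    change P.map (galRestrict A K L B σ) = P at hσ
    change P.map (galRestrict A K L B τ) = P at hτ
    rw [map_mul]
    refine (P.map_map ((galRestrict A K L B τ).toRingHom)
      ((galRestrict A K L B σ).toRingHom)).symm.trans ?_
    exact (congrArg (Ideal.map (galRestrict A K L B σ)) hτ).trans hσ
  inv_mem' := by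
    intro σ hσ
    change P.map (galRestrict A K L B σ⁻¹) = P
    change P.map (galRestrict A K L B σ) = P at hσ
    conv_lhs => rw [← hσ]
    refine (P.map_map ((galRestrict A K L B σ).toRingHom)
      ((galRestrict A K L B σ⁻¹).toRingHom)).trans ?_
    convert! Ideal.map_id P
    ext x
    change (galRestrict A K L B σ⁻¹ * galRestrict A K L B σ) x = x
    rw [← map_mul, inv_mul_cancel, map_one]
    rfl

variable {A K}

theorem le_comap_of_mem_decompositionGroup (P : Ideal B) (σ : decompositionGroup A K (L := L) P) :
    P ≤ P.comap (galRestrict A K L B σ : B →+* B) := by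
  intro x hx
  have h : P.map (galRestrict A K L B σ) = P := σ.2
  rw [Ideal.mem_comap]
  have := Ideal.mem_map_of_mem (galRestrict A K L B (σ : Gal(L/K))) hx
  rw [h] at this
  exact this

/-- The action of the decomposition group of `P` on the completion of `B` at `P`. -/
def completionAction (P : Ideal B) :
    decompositionGroup A K (L := L) P →* (AdicCompletion P B ≃+* AdicCompletion P B) where
  toFun σ := RingEquiv.ofRingHom
    (completionMap P P (galRestrict A K L B σ : B →+* B)
      (le_comap_of_mem_decompositionGroup P σ))
    (completionMap P P (galRestrict A K L B (σ⁻¹ : decompositionGroup A K (L := L) P) : B →+* B)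
      (le_comap_of_mem_decompositionGroup P σ⁻¹))
    (by
      rw [← completionMap_comp P P P _ _ (RingHom.id B) _ _ _ (le_refl P)]
      · exact completionMap_id P _ rfl _
      · ext x
        change x = (galRestrict A K L B (σ : Gal(L/K)) * galRestrict A K L B (σ : Gal(L/K))⁻¹) x
        rw [← map_mul, mul_inv_cancel, map_one]
        rfl)
    (by
      rw [← completionMap_comp P P P _ _ (RingHom.id B) _ _ _ (le_refl P)]
      · exact completionMap_id P _ rfl _
      · ext x
        change x = (galRestrict A K L B (σ : Gal(L/K))⁻¹ * galRestrict A K L B (σ : Gal(L/K))) x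
        rw [← map_mul, inv_mul_cancel, map_one]
        rfl)
  map_one' := by
    ext x : 1
    refine RingHom.congr_fun (completionMap_id P
      (galRestrict A K L B (1 : decompositionGroup A K (L := L) P) : B →+* B) ?_
      (le_comap_of_mem_decompositionGroup P 1)) x
    ext y
    change galRestrict A K L B 1 y = y
    rw [map_one]
    rfl
  map_mul' σ τ := by
    ext x : 1
    refine RingHom.congr_fun (completionMap_comp P P P (galRestrict A K L B τ : B →+* B)
      (galRestrict A K L B σ : B →+* B)
      (galRestrict A K L B (σ * τ : decompositionGroup A K (L := L) P) : B →+* B) ?_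
      (le_comap_of_mem_decompositionGroup P τ) (le_comap_of_mem_decompositionGroup P σ)
      (le_comap_of_mem_decompositionGroup P (σ * τ))) x
    ext y
    change galRestrict A K L B ((σ : Gal(L/K)) * τ) y = _
    rw [map_mul]
    rfl

/-- For a prime `P` of `B` above the maximal ideal of `A`, the ring homomorphism from the
completion of `A` to the completion of `B` at `P`. -/
def completionBaseMap (A : Type*) {B : Type*} [CommRing A] [IsLocalRing A] [CommRing B]
    [Algebra A B] (P : Ideal B) [P.LiesOver (maximalIdeal A)] :
    AdicCompletion (maximalIdeal A) A →+* AdicCompletion P B :=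
  completionMap (maximalIdeal A) P (algebraMap A B) (P.over_def (maximalIdeal A)).le

theorem completionAction_completionBaseMap [IsLocalRing A] (P : Ideal B) [P.LiesOver (maximalIdeal A)]
    (σ : decompositionGroup A K (L := L) P) (x : AdicCompletion (maximalIdeal A) A) :
    completionAction P σ (completionBaseMap A P x) = completionBaseMap A P x := by
  refine (RingHom.congr_fun (completionMap_comp (maximalIdeal A) P P (algebraMap A B)
    (galRestrict A K L B σ : B →+* B) (algebraMap A B) ?_ (P.over_def (maximalIdeal A)).le
    (le_comap_of_mem_decompositionGroup P σ) (P.over_def (maximalIdeal A)).le) x).symm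
  ext y
  exact ((galRestrict A K L B σ).commutes y).symm

end Galois

section LocalFields

variable (A K L : Type*) {B : Type*}
  [CommRing A] [IsDomain A] [IsLocalRing A] [IsNoetherianRing A]

/-- Krull's theorem identifies the domain `A` with a subring of its completion; this is the
resulting embedding of `K = Frac A` in the fraction field `K_m` of the completion of `A`. -/
def baseEmbedding [Field K] [Algebra A K] [IsFractionRing A K]
    [IsDomain (AdicCompletion (maximalIdeal A) A)] :
    K →+* FractionRing (AdicCompletion (maximalIdeal A) A) :=
  IsFractionRing.lift (A := A)
    (g := (algebraMap (AdicCompletion (maximalIdeal A) A) (FractionRing _)).comp (algebraMap A _))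
    ((IsFractionRing.injective (AdicCompletion (maximalIdeal A) A) (FractionRing _)).comp
      (algebraMap_completion_injective (maximalIdeal A) (Ideal.IsPrime.ne_top inferInstance)))

variable [IsIntegrallyClosed A]
  [Field K] [Algebra A K] [IsFractionRing A K]
  [Field L] [Algebra K L] [FiniteDimensional K L] [IsGalois K L]
  [Algebra A L] [IsScalarTower A K L]
  [CommRing B] [Algebra A B] [Algebra B L] [IsScalarTower A B L] [IsIntegralClosure B A L]

/-- The map from the completion of `A` to the completion of `B` at `P` is injective. -/
theorem completionBaseMap_injective (A K L : Type*) {B : Type*}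
    [CommRing A] [IsDomain A] [IsLocalRing A] [IsNoetherianRing A] [IsIntegrallyClosed A]
    [Field K] [Algebra A K] [IsFractionRing A K]
    [Field L] [Algebra K L] [FiniteDimensional K L] [IsGalois K L]
    [Algebra A L] [IsScalarTower A K L]
    [CommRing B] [Algebra A B] [Algebra B L] [IsScalarTower A B L] [IsIntegralClosure B A L]
    (P : Ideal B) [P.IsPrime] [P.LiesOver (maximalIdeal A)] :
    Function.Injective (completionBaseMap A P) := by
  classical
  have hBinj := IsIntegralClosure.algebraMap_injective B A L
  have hdom : IsDomain B := hBinj.isDomain _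
  have hfin : Module.Finite A B := IsIntegralClosure.finite A K L B
  have hnoe : IsNoetherianRing B := IsIntegralClosure.isNoetherianRing A K L B
  have hfrac : IsFractionRing B L := IsIntegralClosure.isFractionRing_of_finite_extension A K L B
  let _ : MulSemiringAction Gal(L/K) B := IsIntegralClosure.MulSemiringAction A K L B
  have hgal : IsGaloisGroup Gal(L/K) A B := IsGaloisGroup.of_isFractionRing _ _ _ K L
  have hABinj : Function.Injective (algebraMap A B) := by
    have h1 : Function.Injective (algebraMap A L) := by
      rw [IsScalarTower.algebraMap_eq A K L]
      exact (algebraMap K L).injective.comp (IsFractionRing.injective A K)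
    rw [IsScalarTower.algebraMap_eq A B L] at h1
    exact Function.Injective.of_comp h1
  have hPmax : P.IsMaximal := Ideal.IsMaximal.of_liesOver_isMaximal P (maximalIdeal A)
  set m := maximalIdeal A with hm
  let conj : Gal(L/K) → Ideal B := fun σ => P.comap (galRestrict A K L B σ : B →+* B)
  let s : Finset (Ideal B) := Finset.univ.image conj
  have hsmax : ∀ Q ∈ s, Q.IsMaximal := by
    intro Q hQ
    obtain ⟨σ, -, rfl⟩ := Finset.mem_image.mp hQ
    exact Ideal.comap_isMaximal_of_surjective _ (galRestrict A K L B σ).surjective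
  have hsall : ∀ Q : Ideal B, Q.IsPrime → m.map (algebraMap A B) ≤ Q → Q ∈ s := by
    intro Q hQ hle
    have hover : Q.LiesOver m := by
      refine ⟨?_⟩
      have h1 : m ≤ Q.comap (algebraMap A B) := Ideal.map_le_iff_le_comap.mp hle
      exact (maximalIdeal.isMaximal A).eq_of_le
        (Ideal.IsPrime.ne_top (Ideal.comap_isPrime (algebraMap A B) Q)) h1
    obtain ⟨σ, hσ⟩ := Ideal.exists_smul_eq_of_isGaloisGroup m Q P Gal(L/K)
    refine Finset.mem_image.mpr ⟨σ, Finset.mem_univ _, ?_⟩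
    change P.comap (galRestrict A K L B σ : B →+* B) = Q
    rw [← hσ]
    exact Ideal.comap_map_of_bijective _ ((galRestrict A K L B σ).bijective)
  obtain ⟨k, hk⟩ := Ideal.exists_radical_pow_le_of_fg (m.map (algebraMap A B))
    (IsNoetherian.noetherian _)
  have hrad : (∏ Q ∈ s, Q) ≤ (m.map (algebraMap A B)).radical := by
    rw [Ideal.radical_eq_sInf]
    refine le_sInf fun Q hQ => ?_
    exact Ideal.prod_le_inf.trans (Finset.inf_le (f := fun Q => Q) (hsall Q hQ.2 hQ.1))
  obtain ⟨c, hc⟩ := Ideal.exists_pow_inf_eq_pow_smul m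
    (LinearMap.range (Algebra.linearMap A B))
  rw [injective_iff_map_eq_zero]
  intro x hx
  refine AdicCompletion.ext_evalₐ fun n => ?_
  rw [map_zero]
  set N := k * (n + c) + n with hN
  obtain ⟨a, ha⟩ := Ideal.Quotient.mk_surjective (AdicCompletion.evalₐ m N x)
  have haP : algebraMap A B a ∈ P ^ N := by
    have h1 := evalₐ_completionMap m P (algebraMap A B)
      (P.over_def m).le N x a ha.symm
    have h2 : completionMap m P (algebraMap A B) (P.over_def m).le x = 0 := hx
    rw [h2, map_zero] at h1
    exact Ideal.Quotient.eq_zero_iff_mem.mp h1.symm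
  have hall : ∀ Q ∈ s, algebraMap A B a ∈ Q ^ N := by
    intro Q hQ
    obtain ⟨σ, -, rfl⟩ := Finset.mem_image.mp hQ
    have h1 : P.comap (galRestrict A K L B σ : B →+* B)
        = P.map ((galRestrict A K L B σ).symm : B →+* B) := by
      exact (Ideal.map_symm (I := P) (galRestrict A K L B σ).toRingEquiv).symm
    change _ ∈ (P.comap (galRestrict A K L B σ : B →+* B)) ^ N
    rw [h1, ← Ideal.map_pow]
    have h2 := Ideal.mem_map_of_mem ((galRestrict A K L B σ).symm : B →+* B) haP
    simpa using h2
  have hprod : algebraMap A B a ∈ (∏ Q ∈ s, Q) ^ N := by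
    rw [← Finset.prod_pow, Ideal.prod_eq_iInf_of_pairwise_isCoprime]
    · simpa [Ideal.mem_iInf] using hall
    · intro Q hQ Q' hQ' hne
      have := hsmax Q hQ
      have := hsmax Q' hQ'
      exact (Ideal.isCoprime_of_isMaximal hne).pow
  have hmB : algebraMap A B a ∈ (m.map (algebraMap A B)) ^ (n + c) := by
    have h1 : (∏ Q ∈ s, Q) ^ N ≤ (m.map (algebraMap A B)) ^ (n + c) := by
      calc (∏ Q ∈ s, Q) ^ N ≤ (∏ Q ∈ s, Q) ^ (k * (n + c)) :=
            Ideal.pow_le_pow_right (by omega)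
        _ = ((∏ Q ∈ s, Q) ^ k) ^ (n + c) := pow_mul _ _ _
        _ ≤ _ := Ideal.pow_right_mono ((Ideal.pow_right_mono hrad k).trans hk) _
    exact h1 hprod
  have hmem : algebraMap A B a ∈ m ^ (n + c) • (⊤ : Submodule A B) ⊓
      LinearMap.range (Algebra.linearMap A B) := by
    refine ⟨?_, ⟨a, rfl⟩⟩
    rw [Ideal.smul_top_eq_map, Ideal.map_pow]
    exact hmB
  rw [hc _ (by omega)] at hmem
  have hmem2 : algebraMap A B a ∈ m ^ n • (LinearMap.range (Algebra.linearMap A B)) := by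
    have h1 : n + c - c = n := by omega
    rw [h1] at hmem
    exact Submodule.smul_mono le_rfl inf_le_right hmem
  rw [LinearMap.range_eq_map, ← Submodule.map_smul''] at hmem2
  obtain ⟨b, hb, hba⟩ := hmem2
  have hab : a = b := (hABinj hba).symm
  subst hab
  have han : a ∈ m ^ n := by simpa using hb
  have h3 : AdicCompletion.evalₐ m n x = Ideal.Quotient.mk (m ^ n) a := by
    obtain ⟨y, rfl⟩ := AdicCompletion.mk_surjective m A x
    rw [AdicCompletion.evalₐ_mk] at ha ⊢
    have h4 : Ideal.Quotient.mk (m ^ n) (y.val n) = Ideal.Quotient.mk (m ^ n) (y.val N) :=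
      (AdicCompletion.Ideal.mk_eq_mk m (by omega : n ≤ N) y).symm
    change Ideal.Quotient.mk (m ^ n) (y.val n) = _
    rw [h4]
    rw [Ideal.Quotient.eq] at ha ⊢
    have h5 := Ideal.pow_le_pow_right (I := m) (by omega : n ≤ N) ha
    rw [← neg_sub]
    exact neg_mem h5
  rw [h3]
  exact Ideal.Quotient.eq_zero_iff_mem.mpr han

/-- The embedding `K_m → L_P` of fraction fields of completions. -/
def localFieldMap (P : Ideal B) [P.IsPrime] [P.LiesOver (maximalIdeal A)]
    [IsDomain (AdicCompletion (maximalIdeal A) A)] [IsDomain (AdicCompletion P B)] :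
    FractionRing (AdicCompletion (maximalIdeal A) A) →+* FractionRing (AdicCompletion P B) :=
  IsFractionRing.map (completionBaseMap_injective A K L P)

theorem algebraMap_completion_injective_of_liesOver (A K L : Type*) {B : Type*}
    [CommRing A] [IsDomain A] [IsLocalRing A] [IsNoetherianRing A] [IsIntegrallyClosed A]
    [Field K] [Algebra A K] [IsFractionRing A K]
    [Field L] [Algebra K L] [FiniteDimensional K L] [IsGalois K L]
    [Algebra A L] [IsScalarTower A K L]
    [CommRing B] [Algebra A B] [Algebra B L] [IsScalarTower A B L] [IsIntegralClosure B A L]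
    (P : Ideal B) [P.IsPrime] :
    Function.Injective (algebraMap B (AdicCompletion P B)) := by
  have hdom : IsDomain B := (IsIntegralClosure.algebraMap_injective B A L).isDomain _
  have hnoe : IsNoetherianRing B := IsIntegralClosure.isNoetherianRing A K L B
  exact algebraMap_completion_injective P (Ideal.IsPrime.ne_top inferInstance)

/-- The embedding `e : L → L_P` extending the natural embedding of `B` in its completion
at `P`. -/
def topEmbedding (P : Ideal B) [P.IsPrime] [IsDomain (AdicCompletion P B)] :
    L →+* FractionRing (AdicCompletion P B) :=
  have _ : IsDomain B := (IsIntegralClosure.algebraMap_injective B A L).isDomain _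
  have _ : IsFractionRing B L := IsIntegralClosure.isFractionRing_of_finite_extension A K L B
  IsFractionRing.lift (A := B)
    (g := (algebraMap (AdicCompletion P B) (FractionRing _)).comp (algebraMap B _))
    ((IsFractionRing.injective (AdicCompletion P B) (FractionRing _)).comp
      (algebraMap_completion_injective_of_liesOver A K L P))

/-- The action of the decomposition group of `P` on the fraction field `L_P` of the
completion of `B` at `P`. -/
def localAction (P : Ideal B) [IsDomain (AdicCompletion P B)] :
    decompositionGroup A K (L := L) P →*
      (FractionRing (AdicCompletion P B) ≃+* FractionRing (AdicCompletion P B)) :=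
  (IsFractionRing.ringEquivOfRingEquivHom (AdicCompletion P B)
    (FractionRing (AdicCompletion P B))).comp (completionAction P)

/-- The decomposition group acts on `L_P` by automorphisms fixing `K_m`. -/
theorem localAction_localFieldMap (P : Ideal B) [P.IsPrime] [P.LiesOver (maximalIdeal A)]
    [IsDomain (AdicCompletion (maximalIdeal A) A)] [IsDomain (AdicCompletion P B)]
    (σ : decompositionGroup A K (L := L) P)
    (x : FractionRing (AdicCompletion (maximalIdeal A) A)) :
    localAction A K L P σ (localFieldMap A K L P x) = localFieldMap A K L P x := by
  have h : ((localAction A K L P σ : FractionRing (AdicCompletion P B) →+*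
      FractionRing (AdicCompletion P B)).comp
      (localFieldMap A K L P)) = localFieldMap A K L P := by
    refine IsFractionRing.ringHom_ext (A := AdicCompletion (maximalIdeal A) A) fun y => ?_
    have h1 : localFieldMap A K L P (algebraMap _ _ y)
        = algebraMap (AdicCompletion P B) (FractionRing (AdicCompletion P B))
          (completionBaseMap A P y) := by
      unfold localFieldMap IsFractionRing.map
      exact IsLocalization.map_eq _ y
    rw [RingHom.comp_apply, h1]
    refine (IsFractionRing.ringEquivOfRingEquiv_algebraMap (K := FractionRing (AdicCompletion P B))
      (L := FractionRing (AdicCompletion P B)) (completionAction P σ) _).trans ?_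
    rw [completionAction_completionBaseMap]
  exact RingHom.congr_fun h x

end LocalFields

/-! ### The two permutation representations -/

/-- Restriction of a permutation representation to an invariant subset. -/
def restrictPerm {G X : Type*} [Group G] (ρ : G →* Equiv.Perm X) (S : Set X)
    (hS : ∀ g, ∀ x ∈ S, ρ g x ∈ S) : G →* Equiv.Perm S where
  toFun g :=
    { toFun := fun x => ⟨ρ g x, hS g x x.2⟩
      invFun := fun x => ⟨ρ g⁻¹ x, hS g⁻¹ x x.2⟩
      left_inv := fun x => Subtype.ext (by simp)
      right_inv := fun x => Subtype.ext (by simp) }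
  map_one' := by ext x; simp
  map_mul' g h := by ext x; simp

/-- The isomorphism `∏ i, Aut (X i) ≃ ∏ k, Aut (Y k)` induced by a bijection `π` of the index
sets and bijections `X i ≃ Y (π i)`. -/
def prodPermCongr {ι κ : Type*} {X : ι → Type*} {Y : κ → Type*} (π : ι ≃ κ)
    (b : ∀ i, X i ≃ Y (π i)) : (∀ i, Equiv.Perm (X i)) ≃* (∀ k, Equiv.Perm (Y k)) :=
  (MulEquiv.piCongrRight fun i => (b i).permCongrHom).trans
    { Equiv.piCongrLeft (fun k => Equiv.Perm (Y k)) π with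
      map_mul' := fun u v => by
        funext k
        obtain ⟨i, rfl⟩ := π.surjective k
        simp [Equiv.piCongrLeft_apply_apply] }

section Orbits

variable {K L : Type*} [Field K] [Field L] [Algebra K L]

/-- The orbits `V_i` of a group `D` of automorphisms on the set `V` of roots of `f` in `L`. -/
def RootOrbit (D : Subgroup Gal(L/K)) (f : K[X]) : Type _ :=
  {O : Set L // ∃ α ∈ f.rootSet L, O = MulAction.orbit D α}

theorem smul_mem_rootOrbit (D : Subgroup Gal(L/K)) (f : K[X]) (O : RootOrbit D f) (σ : D) (x : L)
    (hx : x ∈ O.1) : MulAction.toPermHom D L σ x ∈ O.1 := by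
  obtain ⟨α, -, hO⟩ := O.2
  rw [hO] at hx ⊢
  exact MulAction.mem_orbit_of_mem_orbit σ hx

/-- The homomorphism `i₁ : D → ∏ Aut(V_i)` given by the action on the orbits of the roots. -/
def orbitRepresentation (D : Subgroup Gal(L/K)) (f : K[X]) :
    D →* ∀ O : RootOrbit D f, Equiv.Perm O.1 :=
  MonoidHom.pi fun O => restrictPerm (MulAction.toPermHom D L) O.1 (smul_mem_rootOrbit D f O)

end Orbits

section LocalFactors

/-- The monic irreducible factors of `f` over `F`, for a field embedding `κ : K → F`. -/
def MonicIrreducibleFactor {K F : Type*} [Field K] [Field F] (κ : K →+* F) (f : K[X]) : Type _ :=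
  {g : F[X] // g.Monic ∧ Irreducible g ∧ g ∣ f.map κ}

/-- The set of roots in `E` of a polynomial `g` over `F`, for a field embedding `ι : F → E`. -/
def rootsVia {F E : Type*} [Field F] [Field E] (ι : F →+* E) (g : F[X]) : Set E :=
  {x | g.eval₂ ι x = 0}

variable (A K L : Type*) {B : Type*}
  [CommRing A] [IsDomain A] [IsLocalRing A] [IsNoetherianRing A] [IsIntegrallyClosed A]
  [Field K] [Algebra A K] [IsFractionRing A K]
  [Field L] [Algebra K L] [FiniteDimensional K L] [IsGalois K L]
  [Algebra A L] [IsScalarTower A K L]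
  [CommRing B] [Algebra A B] [Algebra B L] [IsScalarTower A B L] [IsIntegralClosure B A L]
  (P : Ideal B) [P.IsPrime] [P.LiesOver (maximalIdeal A)]
  [IsDomain (AdicCompletion (maximalIdeal A) A)] [IsDomain (AdicCompletion P B)]

theorem localAction_mem_rootsVia (g : (FractionRing (AdicCompletion (maximalIdeal A) A))[X])
    (σ : decompositionGroup A K (L := L) P) (x : FractionRing (AdicCompletion P B))
    (hx : x ∈ rootsVia (localFieldMap A K L P) g) :
    localAction A K L P σ x ∈ rootsVia (localFieldMap A K L P) g := by
  have h : ((localAction A K L P σ : FractionRing (AdicCompletion P B) →+*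
      FractionRing (AdicCompletion P B)).comp
      (localFieldMap A K L P)) = localFieldMap A K L P :=
    RingHom.ext (localAction_localFieldMap A K L P σ)
  have h1 : g.eval₂ (localFieldMap A K L P) x = 0 := hx
  have h2 := congrArg (localAction A K L P σ : FractionRing (AdicCompletion P B) →+*
      FractionRing (AdicCompletion P B)) h1
  rw [Polynomial.hom_eval₂, h, map_zero] at h2
  exact h2

/-- The homomorphism `i₂ : D → ∏ Aut(V_{f_i})` given by the action of the decomposition group on
the roots in `L_P` of the monic irreducible factors `f_i` of `f` over `K_m`. -/
def factorRepresentation (f : K[X]) :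
    decompositionGroup A K (L := L) P →*
      ∀ g : MonicIrreducibleFactor (baseEmbedding A K) f,
        Equiv.Perm (rootsVia (localFieldMap A K L P) g.1) :=
  MonoidHom.pi fun g => restrictPerm
    ((RingAut.toPerm (FractionRing (AdicCompletion P B))).comp (localAction A K L P))
    (rootsVia (localFieldMap A K L P) g.1) (localAction_mem_rootsVia A K L P g.1)

end LocalFactors

end CompletionGalois

end

/-! The main point is that `e` sends the fixed field of `D` in `L` into `K_m`. After clearing
denominators it suffices to treat a `D`-fixed element `b` of `B`. The Chinese remainder theorem
gives an element near 1 at `P` and near 0 at the other conjugates of `P`. Multiplying `b` by it and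
summing over `G/D` gives an element of `A` close to `b` at `P`
(`Algebra.IsInvariant.exists_sub_algebraMap_mem_pow`). So `b` is a `P`-adic limit of elements of
`A`. These form a Cauchy sequence for the maximal ideal of `A`, because an element of `A` in a high
power of `P` lies in the same power of every conjugate, and Artin–Rees applies
(`Algebra.IsInvariant.exists_comap_pow_le`). The limit therefore exists in the completion of `A`.

For an orbit `O` of `D` on the roots, the product of the `X - β` over `β` in `O` is `D`-fixed, hence
defined over `K_m`. The minimal polynomial over `K_m` of one `e α` divides it, and has all of `e(O)`
as roots because `D` acts on `L_P` over `K_m` compatibly with `e`. Thus its roots are exactly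
`e(O)`. Since `f` splits in `L`, every factor over `K_m` has a root of the form `e α`, so all
factors arise. The argument never identifies `D` with a Galois group of `L_P` over `K_m`.

Equivariance of `e` gives `i₂ = j ∘ i₁`. As the roots generate `L`, `i₁` is injective, and so is
`i₂`. -/

/-! ### Invariants of a finite group: approximation at a prime and comparison of topologies -/

open scoped Pointwise in
/-- An element of `B` fixed by the decomposition group of a maximal ideal `P` is congruent to an
invariant element modulo every power of `P`. -/
theorem Algebra.IsInvariant.exists_sub_algebraMap_mem_pow {A B G : Type*} [CommRing A] [CommRing B]
    [Algebra A B] [Group G] [Finite G] [MulSemiringAction G B] [Algebra.IsInvariant A B G]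
    (P : Ideal B) [P.IsMaximal] (b : B) (hb : ∀ σ ∈ MulAction.stabilizer G P, σ • b = b) (N : ℕ) :
    ∃ a : A, b - algebraMap A B a ∈ P ^ N := by
  classical
  have := Fintype.ofFinite G
  set D := MulAction.stabilizer G P with hD
  have hmax (σ : G) : (σ • P).IsMaximal := by
    rw [Ideal.pointwise_smul_eq_comap]
    exact Ideal.comap_isMaximal_of_surjective _ (MulSemiringAction.toRingEquiv G B σ⁻¹).surjective
  have hcop : IsCoprime (P ^ N) (∏ σ ∈ Finset.univ.filter (fun σ : G => σ ∉ D), (σ • P) ^ N) := by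
    refine IsCoprime.prod_right fun σ hσ => ?_
    have := hmax σ
    refine (Ideal.isCoprime_of_isMaximal fun h => (Finset.mem_filter.mp hσ).2 ?_).pow
    exact h.symm
  -- `c` is 1 modulo `P ^ N` and lies in `(σ • P) ^ N` for every `σ` outside `D`.
  obtain ⟨i, hi, c, hc, hic⟩ := Ideal.isCoprime_iff_exists.mp hcop
  have hcσ (σ : G) (hσ : σ ∉ D) : c ∈ (σ • P) ^ N :=
    Ideal.prod_le_inf.trans (Finset.inf_le (Finset.mem_filter.mpr ⟨Finset.mem_univ σ, hσ⟩)) hc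
  have hsmul (σ : G) (Q : Ideal B) (x : B) (hx : x ∈ Q ^ N) : σ • x ∈ (σ • Q) ^ N := by
    have h := Ideal.smul_mem_pointwise_smul σ x (Q ^ N) hx
    rwa [smul_pow'] at h
  -- The norm over `D` makes `c` invariant under `D` and keeps both congruences: each factor is 1
  -- modulo `P ^ N`, and the factor at `τ = 1` is `c` itself.
  set c' : B := ∏ τ : D, (τ : G) • c with hc'
  have hc'D (τ : D) : (τ : G) • c' = c' := by
    rw [hc', Finset.smul_prod']
    exact Fintype.prod_equiv (Equiv.mulLeft τ) _ _ fun x => by simp [mul_smul]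
  have hc'1 : c' - 1 ∈ P ^ N := by
    rw [← Ideal.Quotient.eq, hc', map_prod, map_one]
    refine Finset.prod_eq_one fun τ _ => ?_
    rw [← map_one (Ideal.Quotient.mk (P ^ N)), Ideal.Quotient.eq]
    have h : (τ : G) • P = P := τ.2
    have h1 := hsmul τ P (-i) (neg_mem hi)
    rw [h] at h1
    convert h1 using 1
    have : (τ : G) • i + (τ : G) • c = 1 := by rw [← smul_add, hic, smul_one]
    rw [smul_neg]
    linear_combination this
  have hc'σ (σ : G) (hσ : σ ∉ D) : c' ∈ (σ • P) ^ N := by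
    refine Ideal.mem_of_dvd _ (Finset.dvd_prod_of_mem _ (Finset.mem_univ (1 : D))) ?_
    simpa using hcσ σ hσ
  let y : B := b * c'
  have hy (τ : D) : (τ : G) • y = y := by rw [smul_mul', hb τ τ.2, hc'D]
  -- As `y` is fixed by `D`, its translates depend only on cosets, and their sum over `G ⧸ D` is
  -- invariant under `G`.
  let φ : G ⧸ D → B := fun q => Quotient.liftOn' q (fun σ => σ • y) fun σ τ h => by
    have h1 := hy ⟨_, QuotientGroup.leftRel_apply.mp h⟩
    have h2 := congrArg (σ • ·) h1
    simp only [smul_smul, mul_inv_cancel_left] at h2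
    exact h2.symm
  have hφ (σ : G) : φ (σ : G ⧸ D) = σ • y := rfl
  obtain ⟨a, ha⟩ := Algebra.IsInvariant.isInvariant (A := A) (G := G) (∑ q, φ q) fun g => by
    rw [Finset.smul_sum]
    refine Fintype.sum_equiv (MulAction.toPerm g) _ _ fun q => ?_
    induction q using QuotientGroup.induction_on with
    | H σ => rw [hφ, MulAction.toPerm_apply, MulAction.Quotient.smul_coe, hφ, smul_eq_mul, mul_smul]
  refine ⟨a, ?_⟩
  -- The trivial coset contributes `y`, which is `b` modulo `P ^ N`. Any other coset contributes `σ
  -- • y` with `y` in `(σ⁻¹ • P) ^ N`, hence an element of `P ^ N`.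
  rw [ha, ← Finset.add_sum_erase _ _ (Finset.mem_univ ((1 : G) : G ⧸ D)), hφ, one_smul,
    sub_add_eq_sub_sub]
  refine sub_mem ?_ (sum_mem fun q hq => ?_)
  · have : b - y = -b * (c' - 1) := by ring
    rw [this]
    exact Ideal.mul_mem_left _ _ hc'1
  · induction q using QuotientGroup.induction_on with
    | H σ =>
      have hσ : σ⁻¹ ∉ D := fun h => (Finset.mem_erase.mp hq).1
        (QuotientGroup.eq.mpr (by simpa using h))
      have h := hsmul σ _ _ (Ideal.mul_mem_left _ b (hc'σ _ hσ))
      rwa [smul_inv_smul] at h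

open scoped Pointwise in
/-- For a finite extension of rings with a finite group of automorphisms having ring of invariants
the Noetherian local ring `A`, the topology on `A` induced by the `P`-adic topology is finer than
the topology of `A`. -/
theorem Algebra.IsInvariant.exists_comap_pow_le {A B G : Type*} [CommRing A] [IsLocalRing A]
    [IsNoetherianRing A] [CommRing B] [Algebra A B] [Module.Finite A B]
    (hAB : Function.Injective (algebraMap A B))
    [Group G] [Finite G] [MulSemiringAction G B] [SMulCommClass G A B]
    [Algebra.IsInvariant A B G] (P : Ideal B) [P.IsMaximal] [P.LiesOver (maximalIdeal A)] (n : ℕ) :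
    ∃ N, (P ^ N).comap (algebraMap A B) ≤ maximalIdeal A ^ n := by
  classical
  have := Fintype.ofFinite G
  have : IsNoetherianRing B := IsNoetherianRing.of_finite A B
  set m := maximalIdeal A with hm
  -- A set of ideals rather than a family indexed by `G`: repeated conjugates would destroy pairwise
  -- coprimality.
  let s : Finset (Ideal B) := Finset.univ.image fun σ : G => σ • P
  have hsmax : ∀ Q ∈ s, Q.IsMaximal := by
    intro Q hQ
    obtain ⟨σ, -, rfl⟩ := Finset.mem_image.mp hQ
    rw [Ideal.pointwise_smul_eq_comap]
    exact Ideal.comap_isMaximal_of_surjective _ (MulSemiringAction.toRingEquiv G B σ⁻¹).surjective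
  have hsall : ∀ Q : Ideal B, Q.IsPrime → m.map (algebraMap A B) ≤ Q → Q ∈ s := by
    intro Q hQ hle
    have h1 : m = Q.under A := (maximalIdeal.isMaximal A).eq_of_le
      (Ideal.IsPrime.ne_top (Ideal.comap_isPrime (algebraMap A B) Q))
      (Ideal.map_le_iff_le_comap.mp hle)
    obtain ⟨σ, hσ⟩ := Algebra.IsInvariant.exists_smul_of_under_eq A B G P Q
      ((P.over_def m).symm.trans h1)
    exact Finset.mem_image.mpr ⟨σ, Finset.mem_univ _, hσ.symm⟩
  obtain ⟨k, hk⟩ := Ideal.exists_radical_pow_le_of_fg (m.map (algebraMap A B))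
    (IsNoetherian.noetherian _)
  have hrad : (∏ Q ∈ s, Q) ≤ (m.map (algebraMap A B)).radical := by
    rw [Ideal.radical_eq_sInf]
    refine le_sInf fun Q hQ => ?_
    exact Ideal.prod_le_inf.trans (Finset.inf_le (f := fun Q => Q) (hsall Q hQ.2 hQ.1))
  obtain ⟨c, hc⟩ := Ideal.exists_pow_inf_eq_pow_smul m (LinearMap.range (Algebra.linearMap A B))
  -- The `k`-th power of the product of the conjugates lies in `m B`, so the exponent `k * (n + c)`
  -- reaches `(m B) ^ (n + c)`; intersecting with the image of `A` then costs the Artin–Rees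
  -- constant `c`.
  refine ⟨k * (n + c), fun a ha => ?_⟩
  set N := k * (n + c) with hN
  have hall : ∀ Q ∈ s, algebraMap A B a ∈ Q ^ N := by
    intro Q hQ
    obtain ⟨σ, -, rfl⟩ := Finset.mem_image.mp hQ
    have h := Ideal.smul_mem_pointwise_smul σ _ (P ^ N) (Ideal.mem_comap.mp ha)
    rwa [smul_pow', smul_algebraMap] at h
  have hprod : algebraMap A B a ∈ (∏ Q ∈ s, Q) ^ N := by
    rw [← Finset.prod_pow, Ideal.prod_eq_iInf_of_pairwise_isCoprime]
    · simpa [Ideal.mem_iInf] using hall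
    · intro Q hQ Q' hQ' hne
      have := hsmax Q hQ
      have := hsmax Q' hQ'
      exact (Ideal.isCoprime_of_isMaximal hne).pow
  have hmB : algebraMap A B a ∈ (m.map (algebraMap A B)) ^ (n + c) := by
    rw [hN, pow_mul] at hprod
    exact Ideal.pow_right_mono ((Ideal.pow_right_mono hrad k).trans hk) _ hprod
  have hmem : algebraMap A B a ∈ m ^ (n + c) • (⊤ : Submodule A B) ⊓
      LinearMap.range (Algebra.linearMap A B) := by
    refine ⟨?_, ⟨a, rfl⟩⟩
    rw [Ideal.smul_top_eq_map, Ideal.map_pow]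
    exact hmB
  rw [hc _ (by omega), Nat.add_sub_cancel] at hmem
  have hmem2 : algebraMap A B a ∈ m ^ n • (LinearMap.range (Algebra.linearMap A B)) :=
    Submodule.smul_mono le_rfl inf_le_right hmem
  rw [LinearMap.range_eq_map, ← Submodule.map_smul''] at hmem2
  obtain ⟨a', ha', haa'⟩ := hmem2
  rw [← hAB haa']
  simpa using ha'

/-! ### Fixed elements of `L` lie in `K_m` -/

namespace CompletionGalois

/-- If `b : S` is a limit of elements of `R` for the `J`-adic topology, and the `J`-adic topology
induces on `R` a topology finer than the `I`-adic one, then `b` comes from the completion of `R`. -/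
theorem algebraMap_mem_range_completionMap {R S : Type*} [CommRing R] [CommRing S] (I : Ideal R)
    (J : Ideal S) (φ : R →+* S) (h : I ≤ J.comap φ) (hIJ : ∀ n, ∃ N, (J ^ N).comap φ ≤ I ^ n)
    (b : S) (hb : ∀ n, ∃ a, b - φ a ∈ J ^ n) :
    algebraMap S (AdicCompletion J S) b ∈ (completionMap I J φ h).range := by
  choose N hN using hIJ
  choose a ha using hb
  -- A monotone bound above both `n` and `N n`: the term `N n` makes the approximations Cauchy for
  -- `I`, and the term `n` makes them converge to `b` for `J`.
  let M : ℕ → ℕ := fun n => n + ∑ i ∈ Finset.range (n + 1), N i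
  have hM : Monotone M := fun i j hij => add_le_add hij
    (Finset.sum_le_sum_of_subset (Finset.range_mono (by omega)))
  have hNM (n : ℕ) : N n ≤ M n :=
    (Finset.single_le_sum (f := N) (fun _ _ => Nat.zero_le _) (Finset.self_mem_range_succ n)).trans
      (Nat.le_add_left _ _)
  let x : AdicCompletion.AdicCauchySequence I R :=
    AdicCompletion.AdicCauchySequence.mk I R (fun n => a (M n)) fun n => by
      rw [SModEq.sub_mem, smul_eq_mul, Ideal.mul_top]
      refine hN n (Ideal.pow_le_pow_right (hNM n) ?_)
      have h1 := sub_mem (Ideal.pow_le_pow_right (hM n.le_succ) (ha (M (n + 1)))) (ha (M n))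
      rwa [sub_sub_sub_cancel_left, ← map_sub] at h1
  refine ⟨AdicCompletion.mk I R x, AdicCompletion.ext_evalₐ fun n => ?_⟩
  rw [evalₐ_completionMap I J φ h n _ (a (M n)) (AdicCompletion.evalₐ_mk I n x)]
  simp only [AlgHom.commutes, Ideal.Quotient.algebraMap_eq]
  rw [eq_comm, Ideal.Quotient.eq]
  exact Ideal.pow_le_pow_right (Nat.le_add_right _ _) (ha (M n))

section LocalFields

variable (A K L : Type*) {B : Type*}
  [CommRing A] [IsDomain A] [IsLocalRing A] [IsNoetherianRing A] [IsIntegrallyClosed A]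
  [Field K] [Algebra A K] [IsFractionRing A K]
  [Field L] [Algebra K L] [FiniteDimensional K L] [IsGalois K L]
  [Algebra A L] [IsScalarTower A K L]
  [CommRing B] [Algebra A B] [Algebra B L] [IsScalarTower A B L] [IsIntegralClosure B A L]
  (P : Ideal B) [P.IsPrime]

theorem topEmbedding_algebraMap [IsDomain (AdicCompletion P B)] (b : B) :
    topEmbedding A K L P (algebraMap B L b) = algebraMap (AdicCompletion P B)
      (FractionRing (AdicCompletion P B)) (algebraMap B (AdicCompletion P B) b) := by
  have _ : IsDomain B := (IsIntegralClosure.algebraMap_injective B A L).isDomain _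
  have _ : IsFractionRing B L := IsIntegralClosure.isFractionRing_of_finite_extension A K L B
  have h : Function.Injective ((algebraMap (AdicCompletion P B)
      (FractionRing (AdicCompletion P B))).comp (algebraMap B (AdicCompletion P B))) :=
    (IsFractionRing.injective (AdicCompletion P B) (FractionRing (AdicCompletion P B))).comp
      (algebraMap_completion_injective_of_liesOver A K L P)
  exact IsFractionRing.lift_algebraMap h b

/-- The embedding `L → L_P` is equivariant for the decomposition group. -/
theorem localAction_topEmbedding [IsDomain (AdicCompletion P B)]
    (σ : decompositionGroup A K (L := L) P) (x : L) :
    localAction A K L P σ (topEmbedding A K L P x) = topEmbedding A K L P ((σ : Gal(L/K)) x) := by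
  have _ : IsDomain B := (IsIntegralClosure.algebraMap_injective B A L).isDomain _
  have _ : IsFractionRing B L := IsIntegralClosure.isFractionRing_of_finite_extension A K L B
  have h : ((localAction A K L P σ : FractionRing (AdicCompletion P B) →+*
      FractionRing (AdicCompletion P B)).comp (topEmbedding A K L P)) =
      (topEmbedding A K L P).comp ((σ : Gal(L/K)) : L →+* L) := by
    refine IsFractionRing.ringHom_ext (A := B) fun b => ?_
    rw [RingHom.comp_apply, topEmbedding_algebraMap]
    refine (IsFractionRing.ringEquivOfRingEquiv_algebraMap (K := FractionRing (AdicCompletion P B))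
      (L := FractionRing (AdicCompletion P B)) (completionAction P σ) _).trans ?_
    refine (congrArg (algebraMap (AdicCompletion P B) _)
      (completionMap_algebraMap P P _ (le_comap_of_mem_decompositionGroup P σ) b)).trans ?_
    rw [← topEmbedding_algebraMap A K L P]
    exact congrArg _ (algebraMap_galRestrict_apply A (σ : Gal(L/K)) b)
  exact RingHom.congr_fun h x

variable [P.LiesOver (maximalIdeal A)]

/-- Approximation and comparison of topologies, applied to `Gal(L/K)` acting on `B`. Separability of
`L` over `K` and normality of `A` make `B` finite over `A`. The stabilizer of `P` is the
decomposition group by definition, so `hb` applies unchanged. -/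
theorem algebraMap_mem_range_completionBaseMap (b : B)
    (hb : ∀ σ ∈ decompositionGroup A K (L := L) P, galRestrict A K L B σ b = b) :
    algebraMap B (AdicCompletion P B) b ∈ (completionBaseMap A P).range := by
  have hdom : IsDomain B := (IsIntegralClosure.algebraMap_injective B A L).isDomain _
  have hfin : Module.Finite A B := IsIntegralClosure.finite A K L B
  have hfrac : IsFractionRing B L := IsIntegralClosure.isFractionRing_of_finite_extension A K L B
  let _ : MulSemiringAction Gal(L/K) B := IsIntegralClosure.MulSemiringAction A K L B
  have hgal : IsGaloisGroup Gal(L/K) A B := IsGaloisGroup.of_isFractionRing _ _ _ K L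
  have hAB : Function.Injective (algebraMap A B) := by
    have h1 : Function.Injective (algebraMap A L) := by
      rw [IsScalarTower.algebraMap_eq A K L]
      exact (algebraMap K L).injective.comp (IsFractionRing.injective A K)
    rw [IsScalarTower.algebraMap_eq A B L] at h1
    exact Function.Injective.of_comp h1
  have hPmax : P.IsMaximal := Ideal.IsMaximal.of_liesOver_isMaximal P (maximalIdeal A)
  have := hgal.commutes
  have := hgal.isInvariant
  exact algebraMap_mem_range_completionMap _ _ _ _
    (Algebra.IsInvariant.exists_comap_pow_le (G := Gal(L/K)) hAB P) b
    (Algebra.IsInvariant.exists_sub_algebraMap_mem_pow (G := Gal(L/K)) P b hb)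

variable [IsDomain (AdicCompletion (maximalIdeal A) A)] [IsDomain (AdicCompletion P B)]

theorem localFieldMap_algebraMap (x : AdicCompletion (maximalIdeal A) A) :
    localFieldMap A K L P (algebraMap _ _ x) = algebraMap (AdicCompletion P B)
      (FractionRing (AdicCompletion P B)) (completionBaseMap A P x) := by
  unfold localFieldMap IsFractionRing.map
  exact IsLocalization.map_eq _ x

theorem baseEmbedding_algebraMap {A K : Type*} [CommRing A] [IsDomain A] [IsLocalRing A]
    [IsNoetherianRing A] [Field K] [Algebra A K] [IsFractionRing A K]
    [IsDomain (AdicCompletion (maximalIdeal A) A)] (a : A) :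
    baseEmbedding A K (algebraMap A K a) = algebraMap (AdicCompletion (maximalIdeal A) A)
      (FractionRing (AdicCompletion (maximalIdeal A) A)) (algebraMap A _ a) :=
  IsFractionRing.lift_algebraMap _ a

theorem localFieldMap_algebraMap_algebraMap (a : A) :
    localFieldMap A K L P (algebraMap _ _ (algebraMap A (AdicCompletion (maximalIdeal A) A) a)) =
      topEmbedding A K L P (algebraMap A L a) := by
  rw [localFieldMap_algebraMap, IsScalarTower.algebraMap_apply A B L, topEmbedding_algebraMap]
  exact congrArg _ (completionMap_algebraMap _ _ _ _ a)

/-- The embeddings of `K` in `L_P` through `K_m` and through `L` agree. -/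
theorem localFieldMap_comp_baseEmbedding :
    (localFieldMap A K L P).comp (baseEmbedding A K) =
      (topEmbedding A K L P).comp (algebraMap K L) := by
  refine IsFractionRing.ringHom_ext (A := A) fun a => ?_
  rw [RingHom.comp_apply, baseEmbedding_algebraMap, localFieldMap_algebraMap_algebraMap,
    RingHom.comp_apply, ← IsScalarTower.algebraMap_apply A K L]

/-- The elements of `L` fixed by the decomposition group lie in `K_m`. -/
theorem topEmbedding_mem_range_localFieldMap (x : L)
    (hx : ∀ σ ∈ decompositionGroup A K (L := L) P, σ x = x) :
    topEmbedding A K L P x ∈ (localFieldMap A K L P).range := by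
  have hAL : Function.Injective (algebraMap A L) := by
    rw [IsScalarTower.algebraMap_eq A K L]
    exact (algebraMap K L).injective.comp (IsFractionRing.injective A K)
  obtain ⟨b, a, ha, hab⟩ : ∃ (b : B) (a : A), a ≠ 0 ∧ algebraMap A L a * x = algebraMap B L b := by
    have : Algebra.IsAlgebraic A L := (IsFractionRing.comap_isAlgebraic_iff (K := K)).mpr inferInstance
    obtain ⟨a, ha, hi⟩ := (this.isAlgebraic x).exists_integral_multiple
    refine ⟨IsIntegralClosure.mk' B _ hi, a, ha, ?_⟩
    rw [IsIntegralClosure.algebraMap_mk', Algebra.smul_def]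
  have hb : ∀ σ ∈ decompositionGroup A K (L := L) P, galRestrict A K L B σ b = b := by
    intro σ hσ
    refine IsIntegralClosure.algebraMap_injective B A L ?_
    rw [algebraMap_galRestrict_apply, ← hab, map_mul, hx σ hσ,
      IsScalarTower.algebraMap_apply A K L, AlgEquiv.commutes]
  obtain ⟨y, hy⟩ := algebraMap_mem_range_completionBaseMap A K L P b hb
  -- The range is used as a subfield, so that the denominator `a` can be divided out.
  have h1 : topEmbedding A K L P (algebraMap A L a * x) ∈ (localFieldMap A K L P).fieldRange := by
    rw [hab, topEmbedding_algebraMap, ← hy, ← localFieldMap_algebraMap A K L P]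
    exact ⟨_, rfl⟩
  have h2 : topEmbedding A K L P (algebraMap A L a) ∈ (localFieldMap A K L P).fieldRange :=
    ⟨_, localFieldMap_algebraMap_algebraMap A K L P a⟩
  have h3 : topEmbedding A K L P (algebraMap A L a) ≠ 0 :=
    (_root_.map_ne_zero _).mpr ((map_ne_zero_iff _ hAL).mpr ha)
  rw [map_mul] at h1
  have h4 := div_mem h1 h2
  rwa [mul_div_cancel_left₀ _ h3] at h4

end LocalFields

end CompletionGalois

/-! ### Orbits of roots and irreducible factors, for abstract fields -/

namespace CompletionGalois

section Descent

variable {K L F E : Type*} [Field K] [Field L] [Algebra K L] [Field F] [Field E]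

/-- Monic irreducible polynomials with a common root in an extension are equal. -/
theorem eq_of_mem_rootsVia {ι : F →+* E} {g h : F[X]} (hg : Irreducible g) (hgm : g.Monic)
    (hh : Irreducible h) (hhm : h.Monic) {x : E} (hxg : x ∈ rootsVia ι g)
    (hxh : x ∈ rootsVia ι h) : g = h := by
  let _ := ι.toAlgebra
  exact (minpoly.eq_of_irreducible_of_monic hg hxg hgm).trans
    (minpoly.eq_of_irreducible_of_monic hh hxh hhm).symm

variable (D : Subgroup Gal(L/K)) {f : K[X]} {κ : K →+* F} {ι : F →+* E} {e : L →+* E}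

/-- If the elements of `L` fixed by `D` lie in `F`, an orbit of `D` on the roots of `f` is the set
of roots of an irreducible factor of `f` over `F`. -/
theorem exists_monicIrreducibleFactor_rootsVia_eq [Finite D] (hf : f ≠ 0)
    (hκ : ι.comp κ = e.comp (algebraMap K L)) (ρ : D → E →+* E)
    (hρι : ∀ σ, (ρ σ).comp ι = ι) (hρe : ∀ σ x, ρ σ (e x) = e ((σ : Gal(L/K)) x))
    (hfix : ∀ x : L, (∀ σ ∈ D, σ x = x) → e x ∈ ι.range) (O : RootOrbit D f) :
    ∃ g : MonicIrreducibleFactor κ f, rootsVia ι g.1 = e '' O.1 := by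
  classical
  obtain ⟨_, α, hα, rfl⟩ := O
  let _ := ι.toAlgebra
  have hfin : (MulAction.orbit D α).Finite := Set.finite_range _
  set p : L[X] := ∏ β ∈ hfin.toFinset, (X - C β) with hp
  have hpD (σ : D) : p.map ((σ : Gal(L/K)) : L →+* L) = p := by
    rw [hp, Polynomial.map_prod]
    refine Finset.prod_bij (fun β _ => σ • β) ?_ ?_ ?_ ?_
    · intro β hβ
      rw [Set.Finite.mem_toFinset] at hβ ⊢
      exact MulAction.mem_orbit_of_mem_orbit σ hβ
    · intro β _ γ _ h
      exact smul_left_cancel σ h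
    · intro β hβ
      rw [Set.Finite.mem_toFinset] at hβ
      exact ⟨σ⁻¹ • β, by simpa using MulAction.mem_orbit_of_mem_orbit σ⁻¹ hβ, smul_inv_smul σ β⟩
    · intro β _
      rw [Polynomial.map_sub, map_X, map_C]
      rfl
  -- `D` permutes the linear factors of `p`, so its coefficients are fixed by `D` and `hfix` applies
  -- to each.
  obtain ⟨q, hq⟩ : ∃ q : F[X], q.map ι = p.map e := by
    refine (mem_lifts _).mp ((lifts_iff_coeff_lifts _).mpr fun n => ?_)
    rw [coeff_map]
    refine hfix _ fun σ hσ => ?_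
    have h := congrArg (coeff · n) (hpD ⟨σ, hσ⟩)
    simpa using h
  have hqroot (x : E) (hx : x ∈ rootsVia ι q) : x ∈ e '' MulAction.orbit D α := by
    have h : q.eval₂ ι x = 0 := hx
    rw [← eval_map, hq, hp, Polynomial.map_prod, eval_prod, Finset.prod_eq_zero_iff] at h
    obtain ⟨β, hβ, h⟩ := h
    rw [Polynomial.map_sub, map_X, map_C, eval_sub, eval_X, eval_C, sub_eq_zero] at h
    exact ⟨β, hfin.mem_toFinset.mp hβ, h.symm⟩
  have hqα : aeval (e α) q = 0 := by
    rw [aeval_def, ← eval_map]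
    change (q.map ι).eval (e α) = 0
    rw [hq, eval_map_apply, hp, eval_prod, Finset.prod_eq_zero
      (hfin.mem_toFinset.mpr (MulAction.mem_orbit_self α)) (by simp), map_zero]
  have hq0 : q ≠ 0 := by
    rintro rfl
    rw [Polynomial.map_zero] at hq
    exact (Polynomial.map_ne_zero (f := e) (monic_prod_X_sub_C _ _).ne_zero) hq.symm
  have hint : IsIntegral F (e α) := isAlgebraic_iff_isIntegral.mp ⟨q, hq0, hqα⟩
  have hfα : aeval (e α) (f.map κ) = 0 := by
    rw [aeval_def, eval₂_map]
    change f.eval₂ (ι.comp κ) (e α) = 0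
    rw [hκ, ← hom_eval₂, ← aeval_def, ((mem_rootSet_of_ne hf).mp hα), map_zero]
  refine ⟨⟨minpoly F (e α), minpoly.monic hint, minpoly.irreducible hint, minpoly.dvd _ _ hfα⟩,
    -- The minimal polynomial divides `q`, which bounds its roots by the orbit; conversely `ρ σ`
    -- fixes its coefficients and carries the root `e α` to `e (σ α)`.
    Set.Subset.antisymm (fun x hx => hqroot x ?_) ?_⟩
  · obtain ⟨r, hr⟩ := minpoly.dvd F (e α) hqα
    have h : (minpoly F (e α)).eval₂ ι x = 0 := hx
    change q.eval₂ ι x = 0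
    rw [hr, eval₂_mul, h, zero_mul]
  · rintro _ ⟨_, ⟨σ, rfl⟩, rfl⟩
    have h : (minpoly F (e α)).eval₂ ι (e α) = 0 := minpoly.aeval F (e α)
    have h1 := congrArg (ρ σ) h
    rw [hom_eval₂, hρι, map_zero, hρe] at h1
    exact h1

/-- If the elements of `L` fixed by `D` lie in `F`, the orbits of `D` on the roots of `f`
correspond to the irreducible factors of `f` over `F`, with the same roots. -/
theorem exists_rootOrbit_equiv_monicIrreducibleFactor [Finite D] (hf : f ≠ 0)
    (hsplit : (f.map (algebraMap K L)).Splits)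
    (hκ : ι.comp κ = e.comp (algebraMap K L)) (ρ : D → E →+* E)
    (hρι : ∀ σ, (ρ σ).comp ι = ι) (hρe : ∀ σ x, ρ σ (e x) = e ((σ : Gal(L/K)) x))
    (hfix : ∀ x : L, (∀ σ ∈ D, σ x = x) → e x ∈ ι.range) :
    ∃ π : RootOrbit D f ≃ MonicIrreducibleFactor κ f,
      ∀ O, rootsVia ι (π O).1 = e '' O.1 := by
  choose π hπ using exists_monicIrreducibleFactor_rootsVia_eq D hf hκ ρ hρι hρe hfix
  refine ⟨Equiv.ofBijective π ⟨fun O O' h => ?_, fun g => ?_⟩, hπ⟩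
  -- An orbit is recovered from the roots of its factor because `e` is injective.
  · refine Subtype.ext (Set.image_injective.mpr e.injective ?_)
    rw [← hπ, ← hπ, h]
  · obtain ⟨x, hx⟩ : ∃ x, x ∈ rootsVia ι g.1 := by
      have h1 : (g.1.map ι).Splits := by
        have h2 : ((f.map κ).map ι).Splits := by
          rw [Polynomial.map_map, hκ, ← Polynomial.map_map]
          exact hsplit.map e
        refine h2.of_dvd ?_ (Polynomial.map_dvd ι g.2.2.2)
        rw [Polynomial.map_map]
        exact Polynomial.map_ne_zero hf
      obtain ⟨x, hx⟩ := h1.exists_eval_eq_zero (by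
        rw [degree_map]
        exact g.2.2.1.degree_pos.ne')
      exact ⟨x, (eval_map ι x).symm.trans hx⟩
    -- Since `f` already splits in `L`, it acquires no new roots in `E`.
    obtain ⟨α, hα, rfl⟩ : ∃ α ∈ f.rootSet L, e α = x := by
      obtain ⟨r, hr⟩ := g.2.2.2
      have h1 : (f.map κ).eval₂ ι x = 0 := by
        have h : g.1.eval₂ ι x = 0 := hx
        rw [hr, eval₂_mul, h, zero_mul]
      have h2 : x ∈ ((f.map (algebraMap K L)).map e).roots := by
        rw [mem_roots (Polynomial.map_ne_zero (Polynomial.map_ne_zero hf)), IsRoot.def,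
          Polynomial.map_map, ← hκ, eval_map, ← eval₂_map, h1]
      rw [hsplit.roots_map, Multiset.mem_map] at h2
      obtain ⟨α, hα, rfl⟩ := h2
      refine ⟨α, (mem_rootSet_of_ne hf).mpr ?_, rfl⟩
      rw [aeval_def, ← eval_map]
      exact isRoot_of_mem_roots hα
    let O : RootOrbit D f := ⟨MulAction.orbit D α, α, hα, rfl⟩
    refine ⟨O, Subtype.ext (eq_of_mem_rootsVia (π O).2.2.1 (π O).2.1 g.2.2.1 g.2.1 ?_ hx)⟩
    rw [hπ]
    exact ⟨α, MulAction.mem_orbit_self α, rfl⟩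

/-- A group of automorphisms of a splitting field of `f` acts faithfully on the roots of `f`. -/
theorem orbitRepresentation_injective (f : K[X]) [f.IsSplittingField K L] :
    Function.Injective (orbitRepresentation D f) := by
  rw [injective_iff_map_eq_one]
  intro σ hσ
  refine Subtype.ext (AlgEquiv.ext fun x => ?_)
  have hroot : Set.EqOn ((σ : Gal(L/K)) : L →ₐ[K] L) (AlgHom.id K L) (f.rootSet L) := by
    intro α hα
    let O : RootOrbit D f := ⟨MulAction.orbit D α, α, hα, rfl⟩
    have h := congrArg Subtype.val
      (Equiv.congr_fun (congrFun hσ O) ⟨α, MulAction.mem_orbit_self α⟩)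
    exact h
  have h := AlgHom.ext_of_adjoin_eq_top (IsSplittingField.adjoin_rootSet L f) hroot
  exact AlgHom.congr_fun h x

end Descent

/-! ### Comparison of the permutation representations -/

theorem prodPermCongr_apply_apply {ι κ : Type*} {X : ι → Type*} {Y : κ → Type*} (π : ι ≃ κ)
    (b : ∀ i, X i ≃ Y (π i)) (u : ∀ i, Equiv.Perm (X i)) (i : ι) (x : X i) :
    prodPermCongr π b u (π i) (b i x) = b i (u i x) := by
  change Equiv.piCongrLeft (fun k => Equiv.Perm (Y k)) π (fun i => (b i).permCongr (u i)) (π i)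
    (b i x) = _
  rw [Equiv.piCongrLeft_apply_apply]
  simp

/-- Equivariant bijections between the members of two families of invariant subsets intertwine
the permutation representations on these families. -/
theorem pi_restrictPerm_eq_prodPermCongr_comp {G X Y ι κ : Type*} [Group G]
    (ρ : G →* Equiv.Perm X) (τ : G →* Equiv.Perm Y) (e : X → Y)
    (he : ∀ g x, τ g (e x) = e (ρ g x)) (S : ι → Set X) (T : κ → Set Y)
    (hS : ∀ i, ∀ g, ∀ x ∈ S i, ρ g x ∈ S i) (hT : ∀ k, ∀ g, ∀ y ∈ T k, τ g y ∈ T k)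
    (π : ι ≃ κ) (b : ∀ i, S i ≃ T (π i)) (hb : ∀ i x, (b i x : Y) = e x) :
    MonoidHom.pi (fun k => restrictPerm τ (T k) (hT k)) =
      (prodPermCongr π b).toMonoidHom.comp
        (MonoidHom.pi fun i => restrictPerm ρ (S i) (hS i)) := by
  ext g k y
  -- Writing the index as `π i` and the point as `b i x` avoids transport along equalities of
  -- indices.
  obtain ⟨i, rfl⟩ := π.surjective k
  obtain ⟨x, rfl⟩ := (b i).surjective y
  refine Eq.trans ?_ (congrArg Subtype.val (prodPermCongr_apply_apply (Y := fun k => T k) π b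
    (fun i => restrictPerm ρ (S i) (hS i) g) i x)).symm
  refine Eq.trans ?_ (hb i _).symm
  change τ g (b i x) = e (ρ g x)
  rw [hb, he]

end CompletionGalois

theorem mainTheorem5
    -- a Noetherian local normal domain `A` with fraction field `K`
    {A K L B : Type*}
    [CommRing A] [IsDomain A] [IsLocalRing A] [IsNoetherianRing A] [IsIntegrallyClosed A]
    [Field K] [Algebra A K] [IsFractionRing A K]
    -- an irreducible polynomial `f` with a finite Galois splitting field `L` over `K`
    (f : K[X]) (hf : Irreducible f)
    [Field L] [Algebra K L] [FiniteDimensional K L] [IsGalois K L] [f.IsSplittingField K L]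
    [Algebra A L] [IsScalarTower A K L]
    -- the integral closure `B` of `A` in `L` and a prime `P` of `B` above the maximal ideal
    [CommRing B] [Algebra A B] [Algebra B L] [IsScalarTower A B L] [IsIntegralClosure B A L]
    (P : Ideal B) [P.IsPrime] [P.LiesOver (IsLocalRing.maximalIdeal A)]
    -- the completions of `A` and of `B` at `P` are domains
    [IsDomain (AdicCompletion (IsLocalRing.maximalIdeal A) A)] [IsDomain (AdicCompletion P B)] :
    Function.Injective (CompletionGalois.factorRepresentation A K L P f) ∧
    ∃ (π : CompletionGalois.RootOrbit (CompletionGalois.decompositionGroup A K (L := L) P) f ≃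
          CompletionGalois.MonicIrreducibleFactor (CompletionGalois.baseEmbedding A K) f)
      (b : ∀ O, O.1 ≃ CompletionGalois.rootsVia (CompletionGalois.localFieldMap A K L P) (π O).1),
      -- the bijections `V_i ≃ V_{f_i}` are the restrictions of the embedding `L → L_P`
      (∀ O x, (b O x : FractionRing (AdicCompletion P B)) =
        CompletionGalois.topEmbedding A K L P x) ∧
      CompletionGalois.factorRepresentation A K L P f =
        (CompletionGalois.prodPermCongr π b).toMonoidHom.comp
          (CompletionGalois.orbitRepresentation
            (CompletionGalois.decompositionGroup A K (L := L) P) f) := by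
  obtain ⟨π, hπ⟩ := CompletionGalois.exists_rootOrbit_equiv_monicIrreducibleFactor
    (CompletionGalois.decompositionGroup A K (L := L) P) hf.ne_zero (IsSplittingField.splits L f)
    (CompletionGalois.localFieldMap_comp_baseEmbedding A K L P)
    (fun σ => (CompletionGalois.localAction A K L P σ : _ →+* _))
    (fun σ => RingHom.ext (CompletionGalois.localAction_localFieldMap A K L P σ))
    (CompletionGalois.localAction_topEmbedding A K L P)
    (CompletionGalois.topEmbedding_mem_range_localFieldMap A K L P)
  obtain ⟨b, hb⟩ : ∃ b : ∀ O, O.1 ≃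
      CompletionGalois.rootsVia (CompletionGalois.localFieldMap A K L P) (π O).1,
      ∀ O x, (b O x : FractionRing (AdicCompletion P B)) =
        CompletionGalois.topEmbedding A K L P x :=
    ⟨fun O => (Equiv.Set.image _ O.1 (CompletionGalois.topEmbedding A K L P).injective).trans
      (Equiv.setCongr (hπ O).symm), fun _ _ => rfl⟩
  have hrep := CompletionGalois.pi_restrictPerm_eq_prodPermCongr_comp
    (MulAction.toPermHom (CompletionGalois.decompositionGroup A K (L := L) P) L)
    ((RingAut.toPerm (FractionRing (AdicCompletion P B))).comp
      (CompletionGalois.localAction A K L P))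
    (CompletionGalois.topEmbedding A K L P) (CompletionGalois.localAction_topEmbedding A K L P)
    (fun O : CompletionGalois.RootOrbit _ f => O.1)
    (fun g : CompletionGalois.MonicIrreducibleFactor (CompletionGalois.baseEmbedding A K) f =>
      CompletionGalois.rootsVia (CompletionGalois.localFieldMap A K L P) g.1)
    (CompletionGalois.smul_mem_rootOrbit _ f)
    (fun g => CompletionGalois.localAction_mem_rootsVia A K L P g.1) π b hb
  refine ⟨?_, π, b, hb, hrep⟩
  have hrep' : CompletionGalois.factorRepresentation A K L P f = _ := hrep
  rw [hrep']
  rw [MonoidHom.coe_comp]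
  -- Since `j` is an isomorphism, faithfulness on the roots in `L` passes to the roots in `L_P`.
  refine Function.Injective.comp (MulEquiv.injective _) ?_
  exact CompletionGalois.orbitRepresentation_injective _ f
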